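/- Let $P$ be a set of $n$ points in the plane in general position (no three collinear). An island of $P$ is a set of the form $P\cap C$ with $C\subseteq\mathbb{R}^2$ convex. For integers $0\le l<k\le n$, let $IJ(P,k,l)$ be the graph whose vertices are the islands of $P$ with exactly $k$ elements, two of them being adjacent if their intersection has exactly $l$ elements. Theorem. If $n\ge 2\bigl((k-l)(k-l+1)+k\bigr)$ and $l\le k/2$, then the diameter of $IJ(P,k,l)$ is $O(\log n)+O(k-l)$. That is, there are absolute constants $C_1,C_2$ such that for all such $P,k,l$ the graph $IJ(P,k,l)$ is connected and any two of its vertices are joined by a path of length at most $C_1\log n+C_2(k-l)$. -/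

import Mathlib

/-- The Euclidean plane. -/
abbrev Plane : Type := EuclideanSpace ℝ (Fin 2)

/-- A finite set of points of the plane is in general position if no three distinct points of it
lie on a common line. -/
def InGeneralPosition (P : Finset Plane) : Prop :=
  ∀ p ∈ P, ∀ q ∈ P, ∀ r ∈ P, p ≠ q → p ≠ r → q ≠ r → ¬ Collinear ℝ ({p, q, r} : Set Plane)

/-- `I` is an island of `P` if `I = P ∩ C` for some convex set `C` of the plane. -/
def IsIsland (P I : Finset Plane) : Prop :=
  ∃ C : Set Plane, Convex ℝ C ∧ (I : Set Plane) = (P : Set Plane) ∩ C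

/-- The `k`-islands of `P`: the islands of `P` that have exactly `k` elements. -/
def KIsland (P : Finset Plane) (k : ℕ) : Type :=
  {I : Finset Plane // IsIsland P I ∧ I.card = k}

open Classical in
/-- The generalized island Johnson graph: its vertices are the `k`-islands of `P`, and two
(distinct) `k`-islands are adjacent if their intersection has exactly `l` elements.
(Distinctness is automatic when `l < k`.) -/
def islandJohnsonGraph (P : Finset Plane) (k l : ℕ) : SimpleGraph (KIsland P k) where
  Adj I J := I ≠ J ∧ (I.1 ∩ J.1).card = l
  symm := ⟨fun _ _ h => ⟨h.1.symm, by rw [Finset.inter_comm]; exact h.2⟩⟩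
  loopless := ⟨fun _ h => h.1 rfl⟩

/-! The problem is halved until the point set has size O((k-l)^2), and a sweep finishes it there.

Halving: a ham-sandwich cut (`exists_ham_sandwich`) gives a closed half-plane with about half of `P`
that meets both given islands in at least `l` points, because `k ≥ 2l`. One step moves each island
into that half, and islands of an island are islands of `P`. So a halving costs two steps, and O(log
n) of them suffice.

Sweep: number the points by a linear functional injective on them. Runs of `k` consecutive points,
the windows, are islands. Any `k`-island steps either to a window or into a strip half as long as
its own (`exists_neighbor`), so logarithmically many steps lead to a window. Windows shifted by
`k-l` are adjacent, and O(k-l) such shifts cross the whole set; a shift by one costs two steps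
through a common neighbour (`exists_common_neighbor`).

Intersections of size exactly `l` arise in two ways. Sliding a window by one changes its trace on a
set by at most one point, and among n/k disjoint windows some trace is small, so a discrete
intermediate value argument applies. If a strip with exactly `l` points of the set is long enough,
its trace grows to a `k`-island inside the strip. -/

section

open Finset
open scoped Classical

/-! ### Islands: transitivity, extreme points and growth -/

theorem IsIsland.subset {P I : Finset Plane} (h : IsIsland P I) : I ⊆ P := by
  obtain ⟨C, -, hC⟩ := h
  intro x hx
  have : x ∈ (P : Set Plane) ∩ C := hC ▸ (by exact_mod_cast hx)
  exact_mod_cast this.1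

theorem isIsland_of_mem_iff {P I : Finset Plane} {C : Set Plane} (hC : Convex ℝ C)
    (h : ∀ x, x ∈ I ↔ x ∈ P ∧ x ∈ C) : IsIsland P I :=
  ⟨C, hC, by ext x; simpa using h x⟩

theorem IsIsland.exists_mem_iff {P I : Finset Plane} (h : IsIsland P I) :
    ∃ C : Set Plane, Convex ℝ C ∧ ∀ x, x ∈ I ↔ x ∈ P ∧ x ∈ C := by
  obtain ⟨C, hC, h⟩ := h
  refine ⟨C, hC, fun x => ?_⟩
  have := Set.ext_iff.1 h x
  simpa using this

theorem IsIsland.trans {P Q I : Finset Plane} (hQ : IsIsland P Q) (hI : IsIsland Q I) :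
    IsIsland P I := by
  obtain ⟨C, hC, h⟩ := hQ.exists_mem_iff
  obtain ⟨C', hC', h'⟩ := hI.exists_mem_iff
  refine isIsland_of_mem_iff (hC.inter hC') fun x => ?_
  rw [h', h, Set.mem_inter_iff, and_assoc]

theorem isIsland_refl (P : Finset Plane) : IsIsland P P :=
  isIsland_of_mem_iff convex_univ fun x => by simp

theorem isIsland_empty (P : Finset Plane) : IsIsland P ∅ :=
  isIsland_of_mem_iff convex_empty fun x => by simp

/-- The trace of an island on a subset of the ground set is an island. -/
theorem IsIsland.inter_of_subset {P Q I : Finset Plane} (hI : IsIsland P I) (hQ : Q ⊆ P) :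
    IsIsland Q (I ∩ Q) := by
  obtain ⟨C, hC, h⟩ := hI.exists_mem_iff
  refine isIsland_of_mem_iff hC fun x => ?_
  rw [mem_inter, h]
  constructor
  · tauto
  · intro hx; exact ⟨⟨hQ hx.1, hx.2⟩, hx.1⟩

/-- Outside a proper island there is a point whose deletion leaves an island. -/
theorem IsIsland.exists_erase {Q T : Finset Plane} (hT : IsIsland Q T) (hne : T ≠ Q) :
    ∃ p ∈ Q, p ∉ T ∧ IsIsland Q (Q.erase p) := by
  by_contra! hcon
  have hsub : (convexHull ℝ (Q : Set Plane)).extremePoints ℝ ⊆ T := by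
    intro p hp
    have hpQ : p ∈ Q := by exact_mod_cast extremePoints_convexHull_subset hp
    by_contra hpT
    refine hcon p hpQ (by exact_mod_cast hpT) (isIsland_of_mem_iff (C := convexHull ℝ (Q : Set Plane) \ {p})
      ((Convex.mem_extremePoints_iff_convex_sdiff (convex_convexHull ℝ _)).1 hp).2 fun x => ?_)
    rw [mem_erase]
    constructor
    · rintro ⟨h1, h2⟩
      exact ⟨h2, subset_convexHull ℝ _ (by exact_mod_cast h2), h1⟩
    · rintro ⟨h1, h2⟩
      exact ⟨h2.2, h1⟩
  -- Krein–Milman: the hull of `Q` is the closed hull of its extreme points, all of which lie in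
  -- `T`.
  have hK := closure_convexHull_extremePoints
    (Q.finite_toSet.isCompact_convexHull (𝕜 := ℝ)) (convex_convexHull ℝ (Q : Set Plane))
  have hTc : IsClosed (convexHull ℝ (T : Set Plane)) :=
    (T.finite_toSet.isCompact_convexHull (𝕜 := ℝ)).isClosed
  have hle : convexHull ℝ (Q : Set Plane) ⊆ convexHull ℝ (T : Set Plane) := by
    rw [← hK]
    exact closure_minimal (convexHull_mono hsub) hTc
  obtain ⟨C, hC, h⟩ := hT.exists_mem_iff
  refine hne (Finset.Subset.antisymm hT.subset fun x hx => ?_)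
  refine (h x).2 ⟨hx, convexHull_min (fun y hy => ((h y).1 (by exact_mod_cast hy)).2) hC
    (hle (subset_convexHull ℝ _ (by exact_mod_cast hx)))⟩

/-- Islands can be grown to any prescribed size. -/
theorem IsIsland.exists_superset_card_eq {Q T : Finset Plane} (hT : IsIsland Q T) {j : ℕ}
    (h1 : #T ≤ j) (h2 : j ≤ #Q) : ∃ T', T ⊆ T' ∧ IsIsland Q T' ∧ #T' = j := by
  induction hn : #Q generalizing Q with
  | zero =>
    exact ⟨Q, hT.subset, isIsland_refl Q, by omega⟩
  | succ n ih =>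
    by_cases hj : j = #Q
    · exact ⟨Q, hT.subset, isIsland_refl Q, hj.symm⟩
    · obtain ⟨p, hpQ, hpT, hp⟩ := hT.exists_erase (by rintro rfl; omega)
      have hTs : T ⊆ Q.erase p := fun x hx =>
        mem_erase.2 ⟨fun h => hpT (h ▸ hx), hT.subset hx⟩
      have hT' : IsIsland (Q.erase p) T := by
        have := hT.inter_of_subset (erase_subset p Q)
        rwa [inter_eq_left.2 hTs] at this
      have hc : #(Q.erase p) = #Q - 1 := card_erase_of_mem hpQ
      obtain ⟨T', h3, h4, h5⟩ := ih hT' (by omega) (by omega)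
      exact ⟨T', h3, hp.trans h4, h5⟩

/-! ### Walks of bounded length -/

/-- Two `k`-islands joined by at most `d` exchange steps, each keeping exactly `l` points. -/
inductive Linked (P : Finset Plane) (k l : ℕ) : ℕ → Finset Plane → Finset Plane → Prop
  | refl {d : ℕ} {A : Finset Plane} (hA : IsIsland P A) (hc : #A = k) : Linked P k l d A A
  | step {d : ℕ} {A B C : Finset Plane} (hA : IsIsland P A) (hc : #A = k)
      (hAB : #(A ∩ B) = l) (h : Linked P k l d B C) : Linked P k l (d + 1) A C

namespace Linked
variable {P Q A B C : Finset Plane} {k l d e : ℕ}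

theorem left (h : Linked P k l d A B) : IsIsland P A ∧ #A = k := by
  cases h with
  | refl hA hc => exact ⟨hA, hc⟩
  | step hA hc _ _ => exact ⟨hA, hc⟩

theorem mono (h : Linked P k l d A B) (hde : d ≤ e) : Linked P k l e A B := by
  induction h generalizing e with
  | refl hA hc => exact .refl hA hc
  | step hA hc hAB _ ih =>
    obtain ⟨e, rfl⟩ : ∃ e', e = e' + 1 := ⟨e - 1, by omega⟩
    exact .step hA hc hAB (ih (by omega))

theorem trans (h : Linked P k l d A B) (h' : Linked P k l e B C) : Linked P k l (d + e) A C := by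
  induction h with
  | refl hA hc => exact h'.mono (by omega)
  | step hA hc hAB _ ih =>
    exact (Linked.step hA hc hAB (ih h')).mono (by omega)

theorem single (hA : IsIsland P A) (hAc : #A = k) (hB : IsIsland P B) (hBc : #B = k)
    (h : #(A ∩ B) = l) : Linked P k l 1 A B :=
  .step hA hAc h (.refl (d := 0) hB hBc)

theorem symm (h : Linked P k l d A B) : Linked P k l d B A := by
  induction h with
  | refl hA hc => exact .refl hA hc
  | step hA hc hAB h ih =>
    exact ih.trans (single h.left.1 h.left.2 hA hc (by rwa [inter_comm]))

/-- This lets the halving induction run inside a smaller island. -/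
theorem of_isIsland (hQ : IsIsland P Q) (h : Linked Q k l d A B) : Linked P k l d A B := by
  induction h with
  | refl hA hc => exact .refl (hQ.trans hA) hc
  | step hA hc hAB _ ih => exact .step (hQ.trans hA) hc hAB ih

theorem edist_le (hlk : l < k) {X Y : KIsland P k} (h : Linked P k l d X.1 Y.1) :
    (islandJohnsonGraph P k l).edist X Y ≤ d := by
  generalize hA : X.1 = A at h
  generalize hB : Y.1 = B at h
  induction h generalizing X with
  | refl _ _ =>
    obtain rfl : X = Y := Subtype.ext (hA.trans hB.symm)
    rw [SimpleGraph.edist_self]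
    exact zero_le
  | @step d A B C hA' hc hAB h ih =>
    let Z : KIsland P k := ⟨B, h.left⟩
    have hadj : (islandJohnsonGraph P k l).Adj X Z := by
      refine ⟨?_, ?_⟩
      · intro he
        have : A = B := hA.symm.trans (congrArg Subtype.val he)
        subst this
        rw [inter_self] at hAB
        omega
      · rw [hA]
        convert hAB
    calc (islandJohnsonGraph P k l).edist X Y ≤ (islandJohnsonGraph P k l).edist X Z
          + (islandJohnsonGraph P k l).edist Z Y := SimpleGraph.edist_triangle
      _ ≤ 1 + d := add_le_add (le_of_eq (SimpleGraph.edist_eq_one_iff_adj.2 hadj)) (ih rfl hB)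
      _ = _ := by push_cast; ring

end Linked

/-! ### Functionals, general position and labellings -/

/-- The linear functional with coefficients `a` and `b`. -/
noncomputable def planeFunctional (a b : ℝ) : Plane →ₗ[ℝ] ℝ where
  toFun x := a * x 0 + b * x 1
  map_add' x y := by simp only [PiLp.add_apply]; ring
  map_smul' c x := by simp only [PiLp.smul_apply, smul_eq_mul, RingHom.id_apply]; ring

theorem planeFunctional_apply (a b : ℝ) (x : Plane) :
    planeFunctional a b x = a * x 0 + b * x 1 := rfl

theorem Plane.ext_coords {x y : Plane} (h0 : x 0 = y 0) (h1 : x 1 = y 1) : x = y := by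
  ext i
  fin_cases i
  · exact h0
  · exact h1

theorem collinear_of_planeFunctional_eq {a b t : ℝ} (hab : 0 < a ^ 2 + b ^ 2) {s : Set Plane}
    {p : Plane} (hp : p ∈ s) (hs : ∀ x ∈ s, planeFunctional a b x = t) : Collinear ℝ s := by
  rw [collinear_iff_of_mem hp]
  refine ⟨!₂[-b, a], fun x hx => ⟨(-b * (x 0 - p 0) + a * (x 1 - p 1)) / (a ^ 2 + b ^ 2), ?_⟩⟩
  have h1 := hs x hx
  have h2 := hs p hp
  rw [planeFunctional_apply] at h1 h2
  have hne := hab.ne'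
  apply Plane.ext_coords
  · simp only [vadd_eq_add, PiLp.add_apply, PiLp.smul_apply, smul_eq_mul]
    simp
    field_simp
    linear_combination (-a) * h2 + a * h1
  · simp only [vadd_eq_add, PiLp.add_apply, PiLp.smul_apply, smul_eq_mul]
    simp
    field_simp
    linear_combination (-b) * h2 + b * h1

theorem InGeneralPosition.subset {P Q : Finset Plane} (h : InGeneralPosition P) (hQ : Q ⊆ P) :
    InGeneralPosition Q :=
  fun p hp q hq r hr => h p (hQ hp) q (hQ hq) r (hQ hr)

theorem InGeneralPosition.card_line_le {P : Finset Plane} (h : InGeneralPosition P) {a b : ℝ}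
    (hab : 0 < a ^ 2 + b ^ 2) (t : ℝ) : #{x ∈ P | planeFunctional a b x = t} ≤ 2 := by
  by_contra! hc
  obtain ⟨p, q, r, hp, hq, hr, h1, h2, h3⟩ := two_lt_card_iff.1 hc
  rw [mem_filter] at hp hq hr
  refine h p hp.1 q hq.1 r hr.1 h1 h2 h3
    (collinear_of_planeFunctional_eq (t := t) (p := p) hab (by simp) ?_)
  rintro x (rfl | rfl | rfl)
  exacts [hp.2, hq.2, hr.2]

/-- The points of `P` whose label lies in `[a, b)`. -/
def strip (P : Finset Plane) (r : Plane → ℕ) (a b : ℕ) : Finset Plane :=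
  {p ∈ P | a ≤ r p ∧ r p < b}

theorem mem_strip {P : Finset Plane} {r : Plane → ℕ} {a b : ℕ} {x : Plane} :
    x ∈ strip P r a b ↔ x ∈ P ∧ a ≤ r x ∧ r x < b := mem_filter

/-- A labelling of the points of `P` by `0, …, #P - 1` whose intervals are islands. -/
structure IsConvexLabelling (P : Finset Plane) (r : Plane → ℕ) : Prop where
  injOn : Set.InjOn r P
  image_eq : P.image r = range #P
  isIsland_strip : ∀ a b, IsIsland P (strip P r a b)

/-- The labelling of the points of `P` by their rank under a functional. -/
noncomputable def rank (P : Finset Plane) (f : Plane →ₗ[ℝ] ℝ) (x : Plane) : ℕ :=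
  #{q ∈ P | f q < f x}

theorem isConvexLabelling_rank {P : Finset Plane} {f : Plane →ₗ[ℝ] ℝ} (hf : Set.InjOn f P) :
    IsConvexLabelling P (rank P f) := by
  have hlt : ∀ p ∈ P, ∀ q, f p < f q → rank P f p < rank P f q := by
    intro p hp q hpq
    refine card_lt_card ⟨fun x hx => ?_, fun hsub => ?_⟩
    · rw [mem_filter] at hx ⊢
      exact ⟨hx.1, hx.2.trans hpq⟩
    · exact lt_irrefl _ (mem_filter.1 (hsub (mem_filter.2 ⟨hp, hpq⟩))).2
  have hinj : Set.InjOn (rank P f) P := by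
    intro p hp q hq h
    refine hf hp hq ?_
    rcases lt_trichotomy (f p) (f q) with h' | h' | h'
    · exact absurd h (hlt p hp q h').ne
    · exact h'
    · exact absurd h (hlt q hq p h').ne'
  refine ⟨hinj, ?_, fun a b => ?_⟩
  · refine eq_of_subset_of_card_le ?_ ?_
    · intro n hn
      obtain ⟨p, hp, rfl⟩ := mem_image.1 hn
      rw [mem_range]
      refine card_lt_card ⟨filter_subset _ _, fun hsub => ?_⟩
      exact lt_irrefl _ (mem_filter.1 (hsub hp)).2
    · rw [card_range, card_image_of_injOn hinj]
  · let S : Set ℝ := {t | a ≤ #{q ∈ P | f q < t} ∧ #{q ∈ P | f q < t} < b}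
    have hmono : ∀ s t : ℝ, s ≤ t → #{q ∈ P | f q < s} ≤ #{q ∈ P | f q < t} := by
      intro s t hst
      refine card_le_card fun x hx => ?_
      rw [mem_filter] at hx ⊢
      exact ⟨hx.1, hx.2.trans_le hst⟩
    have hS : S.OrdConnected := by
      refine ⟨fun x hx y hy z hz => ⟨?_, ?_⟩⟩
      · exact hx.1.trans (hmono _ _ hz.1)
      · exact (hmono _ _ hz.2).trans_lt hy.2
    exact isIsland_of_mem_iff (hS.convex.linear_preimage f) fun x => mem_strip

/-- In general position, any two points are consecutive in some convex labelling. -/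
theorem InGeneralPosition.exists_labelling {P : Finset Plane} (h : InGeneralPosition P)
    {p q : Plane} (hp : p ∈ P) (hq : q ∈ P) (hpq : p ≠ q) :
    ∃ r, IsConvexLabelling P r ∧ r q = r p + 1 := by
  set v : Plane := q - p with hv
  have hv0 : v 0 = q 0 - p 0 := rfl
  have hv1 : v 1 = q 1 - p 1 := rfl
  have hvpos : 0 < v 0 ^ 2 + v 1 ^ 2 := by
    by_contra! hle
    have e0 : v 0 = 0 := by nlinarith [sq_nonneg (v 0), sq_nonneg (v 1)]
    have e1 : v 1 = 0 := by nlinarith [sq_nonneg (v 0), sq_nonneg (v 1)]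
    exact hpq (Plane.ext_coords (by linarith) (by linarith))
  set g₀ := planeFunctional (-v 1) (v 0) with hg₀
  set f₀ := planeFunctional (v 0) (v 1) with hf₀
  have hg₀pq : g₀ p = g₀ q := by
    simp only [hg₀, planeFunctional_apply, hv0, hv1]; ring
  have hf₀pq : f₀ p < f₀ q := by
    simp only [hf₀, planeFunctional_apply]
    rw [hv0, hv1] at *
    nlinarith
  have hz : ∀ z ∈ P, z ≠ p → z ≠ q → g₀ z ≠ g₀ p := by
    intro z hzP hzp hzq he
    refine h p hp q hq z hzP hpq hzp.symm hzq.symm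
      (collinear_of_planeFunctional_eq (a := -v 1) (b := v 0) (t := g₀ p) (p := p)
        (by linarith [neg_sq (v 1)]) (by simp) ?_)
    rintro x (rfl | rfl | rfl)
    exacts [rfl, hg₀pq.symm, he]
  -- `g₀` is constant on the line `pq`. A small multiple of `f₀` breaks its ties without reversing
  -- any strict inequality on the finite set `P`.
  obtain ⟨ε, hε, hlt⟩ : ∃ ε : ℝ, 0 < ε ∧ ∀ x ∈ P, ∀ y ∈ P, g₀ x < g₀ y →
      g₀ x + ε * f₀ x < g₀ y + ε * f₀ y := by
    have hev : ∀ᶠ ε in nhdsWithin (0 : ℝ) (Set.Ioi 0), ∀ x ∈ P, ∀ y ∈ P, g₀ x < g₀ y →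
        g₀ x + ε * f₀ x < g₀ y + ε * f₀ y := by
      rw [Filter.eventually_all_finset]
      intro x _
      rw [Filter.eventually_all_finset]
      intro y _
      by_cases hxy : g₀ x < g₀ y
      · have h1 : Continuous fun ε : ℝ => g₀ x + ε * f₀ x := by fun_prop
        have h2 : Continuous fun ε : ℝ => g₀ y + ε * f₀ y := by fun_prop
        have := (isOpen_lt h1 h2).mem_nhds (x := (0 : ℝ)) (by simpa using hxy)
        filter_upwards [nhdsWithin_le_nhds this] with ε hε _ using hε
      · exact Filter.Eventually.of_forall fun ε hc => absurd hc hxy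
    obtain ⟨ε, h1, h2⟩ := (hev.and self_mem_nhdsWithin).exists
    exact ⟨ε, h2, h1⟩
  set g := g₀ + ε • f₀ with hg
  have hgx : ∀ x, g x = g₀ x + ε * f₀ x := fun x => rfl
  have hinj : Set.InjOn g P := by
    intro x hx y hy hxy
    rw [hgx, hgx] at hxy
    have h1 : g₀ x = g₀ y := by
      rcases lt_trichotomy (g₀ x) (g₀ y) with h' | h' | h'
      · exact absurd hxy (hlt x hx y hy h').ne
      · exact h'
      · exact absurd hxy (hlt y hy x hx h').ne'
    have h2 : f₀ x = f₀ y := by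
      rw [h1] at hxy
      exact mul_left_cancel₀ hε.ne' (by linarith)
    simp only [hg₀, hf₀, planeFunctional_apply] at h1 h2
    have e0 : (v 0 ^ 2 + v 1 ^ 2) * (x 0 - y 0) = 0 := by
      linear_combination (-v 1) * h1 + v 0 * h2
    have e1 : (v 0 ^ 2 + v 1 ^ 2) * (x 1 - y 1) = 0 := by
      linear_combination (v 0) * h1 + v 1 * h2
    have e0' := (mul_eq_zero.1 e0).resolve_left hvpos.ne'
    have e1' := (mul_eq_zero.1 e1).resolve_left hvpos.ne'
    exact Plane.ext_coords (by linarith) (by linarith)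
  have hgpq : g p < g q := by
    rw [hgx, hgx, hg₀pq]
    have := mul_lt_mul_of_pos_left hf₀pq hε
    linarith
  refine ⟨rank P g, isConvexLabelling_rank hinj, ?_⟩
  -- No third point lies on the line `pq`, so the perturbation leaves nothing between `p` and `q`.
  have : {z ∈ P | g z < g q} = insert p {z ∈ P | g z < g p} := by
    ext z
    rw [mem_insert, mem_filter, mem_filter]
    constructor
    · rintro ⟨hzP, hlt'⟩
      by_cases hzp : z = p
      · exact Or.inl hzp
      · refine Or.inr ⟨hzP, ?_⟩
        have hzq : z ≠ q := by rintro rfl; exact lt_irrefl _ hlt'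
        rcases lt_or_gt_of_ne (hz z hzP hzp hzq) with h' | h'
        · exact hlt z hzP p hp h'
        · exact absurd hlt' (hlt q hq z hzP (hg₀pq ▸ h')).not_gt
    · rintro (rfl | ⟨hzP, hlt'⟩)
      · exact ⟨hp, hgpq⟩
      · exact ⟨hzP, hlt'.trans hgpq⟩
  rw [rank, this, card_insert_of_notMem (by simp), rank]

theorem InGeneralPosition.exists_labelling' {P : Finset Plane} (h : InGeneralPosition P)
    (hP : 1 < #P) : ∃ r, IsConvexLabelling P r := by
  obtain ⟨p, hp, q, hq, hpq⟩ := one_lt_card.1 hP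
  obtain ⟨r, hr, -⟩ := h.exists_labelling hp hq hpq
  exact ⟨r, hr⟩

/-! ### Counting in strips and sliding windows -/

theorem strip_subset {P : Finset Plane} {r : Plane → ℕ} {a b : ℕ} : strip P r a b ⊆ P :=
  filter_subset _ _

theorem strip_mono {P : Finset Plane} {r : Plane → ℕ} {a b a' b' : ℕ} (ha : a' ≤ a)
    (hb : b ≤ b') : strip P r a b ⊆ strip P r a' b' := by
  intro x hx
  rw [mem_strip] at hx ⊢
  exact ⟨hx.1, ha.trans hx.2.1, hx.2.2.trans_le hb⟩

theorem card_strip_add {T : Finset Plane} {r : Plane → ℕ} {a b c : ℕ} (hab : a ≤ b)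
    (hbc : b ≤ c) : #(strip T r a b) + #(strip T r b c) = #(strip T r a c) := by
  rw [← card_union_of_disjoint]
  · congr 1
    ext x
    simp only [mem_union, mem_strip]
    constructor
    · rintro (h | h)
      · exact ⟨h.1, h.2.1, h.2.2.trans_le hbc⟩
      · exact ⟨h.1, hab.trans h.2.1, h.2.2⟩
    · intro h
      rcases lt_or_ge (r x) b with h' | h'
      · exact Or.inl ⟨h.1, h.2.1, h'⟩
      · exact Or.inr ⟨h.1, h', h.2.2⟩
  · rw [disjoint_left]
    intro x hx hx'
    rw [mem_strip] at hx hx'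
    omega

theorem strip_inter_of_subset {P T : Finset Plane} {r : Plane → ℕ} {a b : ℕ} (hT : T ⊆ P) :
    T ∩ strip P r a b = strip T r a b := by
  ext x
  simp only [mem_inter, mem_strip]
  constructor
  · tauto
  · intro h; exact ⟨h.1, hT h.1, h.2⟩

theorem card_strip_succ_le {T : Finset Plane} {r : Plane → ℕ} (hr : Set.InjOn r T) (a : ℕ) :
    #(strip T r a (a + 1)) ≤ 1 := by
  rw [card_le_one]
  intro x hx y hy
  rw [mem_strip] at hx hy
  exact hr hx.1 hy.1 (by omega)

/-- Both sides count the labels from `s` to `s + k`. As single labels carry at most one point,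
sliding a window changes its count by at most one. -/
theorem card_window_step {T : Finset Plane} {r : Plane → ℕ} (s k : ℕ) :
    #(strip T r s (s + k)) + #(strip T r (s + k) (s + k + 1)) =
      #(strip T r s (s + 1)) + #(strip T r (s + 1) (s + 1 + k)) := by
  rw [card_strip_add (by omega) (by omega), card_strip_add (by omega) (by omega)]
  congr 2
  omega

/-- Some window of length `k` meets `T` in few points. -/
theorem exists_window_lt {T : Finset Plane} {r : Plane → ℕ} {N k j : ℕ}
    (h : #T < j * (N / k)) : ∃ s, s + k ≤ N ∧ #(strip T r s (s + k)) < j := by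
  by_contra! hc
  -- Pigeonhole over the `N / k` disjoint windows starting at multiples of `k`.
  have key : ∀ i, i * k ≤ N → i * j ≤ #(strip T r 0 (i * k)) := by
    intro i
    induction i with
    | zero => simp
    | succ i ih =>
      intro hi
      have e : (i + 1) * k = i * k + k := by ring
      rw [e] at hi ⊢
      have h1 := ih (by omega)
      have h2 := hc (i * k) hi
      have h3 := card_strip_add (T := T) (r := r) (Nat.zero_le (i * k)) (Nat.le_add_right (i * k) k)
      have e2 : (i + 1) * j = i * j + j := by ring
      omega
  have h1 := key (N / k) (Nat.div_mul_le_self N k)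
  have h2 : #(strip T r 0 (N / k * k)) ≤ #T := card_le_card strip_subset
  rw [mul_comm] at h
  omega

/-- A discrete intermediate value theorem. -/
theorem exists_eq_of_steps {c : ℕ → ℕ} {M l : ℕ} (h1 : ∀ s < M, c (s + 1) ≤ c s + 1)
    (h2 : ∀ s < M, c s ≤ c (s + 1) + 1) {x y : ℕ} (hx : x ≤ M) (hy : y ≤ M) (hcx : c x ≤ l)
    (hcy : l ≤ c y) : ∃ z ≤ M, c z = l := by
  by_contra! hc
  have key : ∀ s < M, (c s < l ↔ c (s + 1) < l) := by
    intro s hs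
    have a1 := h1 s hs
    have a2 := h2 s hs
    have a3 := hc s hs.le
    have a4 := hc (s + 1) hs
    omega
  have all : ∀ s ≤ M, (c s < l ↔ c 0 < l) := by
    intro s
    induction s with
    | zero => simp
    | succ s ih => intro hs; rw [← key s hs, ih (by omega)]
  have b1 := all x hx
  have b2 := all y hy
  have b3 := hc x hx
  omega

theorem exists_window_superset {x y N k : ℕ} (hxy : y ≤ x + k) (hy : y ≤ N) (hk : k ≤ N) :
    ∃ s, s ≤ x ∧ y ≤ s + k ∧ s + k ≤ N := by
  rcases le_total x (N - k) with h | h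
  · exact ⟨x, le_rfl, hxy, by omega⟩
  · exact ⟨N - k, h, by omega, by omega⟩

/-- A strip with at least `l` points of `T` contains one with exactly `l` points. -/
theorem exists_strip_card_eq {T : Finset Plane} {r : Plane → ℕ} (hr : Set.InjOn r T)
    {x y l : ℕ} (hxy : x ≤ y) (h : l ≤ #(strip T r x y)) :
    ∃ x', x ≤ x' ∧ x' ≤ y ∧ #(strip T r x' y) = l := by
  have hstep : ∀ s < y - x, #(strip T r (x + s) y) =
      #(strip T r (x + s) (x + s + 1)) + #(strip T r (x + (s + 1)) y) := fun s hs =>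
    (card_strip_add (by omega) (by omega)).symm
  obtain ⟨z, hz, he⟩ := exists_eq_of_steps (c := fun s => #(strip T r (x + s) y)) (M := y - x)
    (l := l) (x := y - x) (y := 0) (fun s hs => by have := hstep s hs; omega)
    (fun s hs => by
      have := hstep s hs
      have := card_strip_succ_le hr (x + s)
      omega) le_rfl (Nat.zero_le _)
    (by
      have : strip T r (x + (y - x)) y = ∅ := by
        ext p
        simp only [mem_strip, notMem_empty, iff_false]
        omega
      simp [this])
    (by simpa using h)
  exact ⟨x + z, by omega, by omega, he⟩

/-! ### From an island to a window -/

namespace IsConvexLabelling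
variable {P T : Finset Plane} {r : Plane → ℕ}

theorem lt_card (h : IsConvexLabelling P r) {p : Plane} (hp : p ∈ P) : r p < #P :=
  mem_range.1 (h.image_eq ▸ mem_image_of_mem r hp)

theorem exists_eq (h : IsConvexLabelling P r) {n : ℕ} (hn : n < #P) : ∃ p ∈ P, r p = n :=
  mem_image.1 (h.image_eq.symm ▸ mem_range.2 hn)

theorem card_strip (h : IsConvexLabelling P r) {a b : ℕ} (hb : b ≤ #P) :
    #(strip P r a b) = b - a := by
  have : (strip P r a b).image r = Ico a b := by
    ext n
    rw [mem_image, mem_Ico]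
    constructor
    · rintro ⟨p, hp, rfl⟩
      exact (mem_strip.1 hp).2
    · intro hn
      obtain ⟨p, hp, rfl⟩ := h.exists_eq (n := n) (by omega)
      exact ⟨p, mem_strip.2 ⟨hp, hn⟩, rfl⟩
  rw [← Nat.card_Ico, ← this, card_image_of_injOn (h.injOn.mono (by exact_mod_cast strip_subset))]

theorem card_window (h : IsConvexLabelling P r) {s k : ℕ} (hs : s + k ≤ #P) :
    #(strip P r s (s + k)) = k := by
  rw [h.card_strip hs]; omega

theorem strip_eq_self (h : IsConvexLabelling P r) (hT : T ⊆ P) : strip T r 0 #P = T := by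
  ext p
  rw [mem_strip]
  exact ⟨fun h => h.1, fun hp => ⟨hp, Nat.zero_le _, h.lt_card (hT hp)⟩⟩

/-- An island meeting a long strip in exactly `l` points can be replaced by a `k`-island in that
strip with the same trace. -/
theorem exists_island_strip (h : IsConvexLabelling P r) (hT : IsIsland P T) {x y k l : ℕ}
    (hlk : l ≤ k) (hxy : x + k ≤ y) (hy : y ≤ #P) (hl : #(strip T r x y) = l) :
    ∃ A, IsIsland P A ∧ #A = k ∧ strip T r x y ⊆ A ∧ A ⊆ strip P r x y := by
  have h1 := hT.inter_of_subset (strip_subset (P := P) (r := r) (a := x) (b := y))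
  rw [strip_inter_of_subset hT.subset] at h1
  obtain ⟨A, h2, h3, h4⟩ := h1.exists_superset_card_eq (j := k) (by omega)
    (by rw [h.card_strip hy]; omega)
  exact ⟨A, (h.isIsland_strip x y).trans h3, h4, h2, h3.subset⟩

theorem inter_eq_strip (hT : T ⊆ P) {A : Finset Plane} {x y : ℕ} (h1 : strip T r x y ⊆ A)
    (h2 : A ⊆ strip P r x y) : T ∩ A = strip T r x y := by
  refine Subset.antisymm ?_ fun z hz => mem_inter.2 ⟨strip_subset hz, h1 hz⟩
  rw [← strip_inter_of_subset hT]
  exact inter_subset_inter_left h2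

/-- From an island with at least `l` points in a strip one can move to a window, or to a
`k`-island inside that strip. -/
theorem exists_neighbor (h : IsConvexLabelling P r) (hT : IsIsland P T) {x y k l : ℕ}
    (hlk : l ≤ k) (hk : k ≤ #P) (hxy : x ≤ y) (hy : y ≤ #P) (hl : l ≤ #(strip T r x y))
    (hN : #T < (l + 1) * (#P / k)) :
    ∃ A, IsIsland P A ∧ #A = k ∧ #(T ∩ A) = l ∧
      ((∃ s, s + k ≤ #P ∧ A = strip P r s (s + k)) ∨ (A ⊆ strip P r x y ∧ k < y - x)) := by
  have hinj : Set.InjOn r T := h.injOn.mono (by exact_mod_cast hT.subset)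
  obtain ⟨x', hx', hx'y, hx'l⟩ := exists_strip_card_eq hinj hxy hl
  -- A short strip lies in a window with at least `l` points of `T`; another window has at most `l`,
  -- so one in between has exactly `l`. A long strip has room to grow its trace.
  rcases le_or_gt (y - x') k with hlen | hlen
  · obtain ⟨s, hs1, hs2, hs3⟩ := exists_window_superset (x := x') (y := y) (k := k)
      (by omega) hy hk
    obtain ⟨u, hu1, hu2⟩ := exists_window_lt (r := r) hN
    obtain ⟨z, hz, he⟩ := exists_eq_of_steps (c := fun s => #(strip T r s (s + k)))
      (M := #P - k) (l := l) (x := u) (y := s)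
      (fun s _ => by
        have := card_window_step (T := T) (r := r) s k
        have := card_strip_succ_le hinj (s + k)
        omega)
      (fun s _ => by
        have := card_window_step (T := T) (r := r) s k
        have := card_strip_succ_le hinj s
        omega) (by omega) (by omega) (by omega)
      (by
        rw [← hx'l]
        exact card_le_card (strip_mono hs1 hs2))
    refine ⟨strip P r z (z + k), h.isIsland_strip _ _, h.card_window (by omega), ?_,
      Or.inl ⟨z, by omega, rfl⟩⟩
    rw [strip_inter_of_subset hT.subset, he]
  · obtain ⟨A, h1, h2, h3, h4⟩ := h.exists_island_strip hT hlk (by omega) hy hx'l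
    exact ⟨A, h1, h2, by rw [inter_eq_strip hT.subset h3 h4, hx'l],
      Or.inr ⟨h4.trans (strip_mono hx' le_rfl), by omega⟩⟩

/-- Every `k`-island is few steps away from a window. -/
theorem exists_linked_window (h : IsConvexLabelling P r) {k l : ℕ} (hlk : l < k)
    (hl2 : 2 * l ≤ k) (hk : k ≤ #P) (hN : k < (l + 1) * (#P / k)) (t : ℕ) :
    ∀ (A : Finset Plane) (x y : ℕ), IsIsland P A → #A = k → x ≤ y → y ≤ #P →
      A ⊆ strip P r x y → y ≤ x + 2 ^ t →
      ∃ s, s + k ≤ #P ∧ Linked P k l (t + 1) A (strip P r s (s + k)) := by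
  induction t with
  | zero =>
    intro A x y hA hAk hxy hy hAs hlen
    have hall : strip A r x y = A := by
      rw [← strip_inter_of_subset hA.subset, inter_eq_left.2 hAs]
    obtain ⟨B, hB, hBk, hAB, ⟨s, hs, rfl⟩ | ⟨-, hlt⟩⟩ :=
      h.exists_neighbor hA hlk.le hk hxy hy (by rw [hall]; omega) (by omega)
    · exact ⟨s, hs, .single hA hAk hB hBk hAB⟩
    · simp only [pow_zero] at hlen; omega
  | succ t ih =>
    intro A x y hA hAk hxy hy hAs hlen
    have hall : strip A r x y = A := by
      rw [← strip_inter_of_subset hA.subset, inter_eq_left.2 hAs]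
    rw [pow_succ] at hlen
    have hsum := card_strip_add (T := A) (r := r) (a := x) (b := (x + y) / 2) (c := y)
      (by omega) (by omega)
    rw [hall, hAk] at hsum
    -- One half of the strip keeps at least `l` of the `k ≥ 2l` points of `A`.
    obtain ⟨x', y', hxy', hy', hlen', hl'⟩ : ∃ x' y', x' ≤ y' ∧ y' ≤ #P ∧ y' ≤ x' + 2 ^ t ∧
        l ≤ #(strip A r x' y') := by
      by_cases hc : l ≤ #(strip A r x ((x + y) / 2))
      · exact ⟨x, (x + y) / 2, by omega, by omega, by omega, hc⟩
      · exact ⟨(x + y) / 2, y, by omega, by omega, by omega, by omega⟩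
    obtain ⟨B, hB, hBk, hAB, ⟨s, hs, rfl⟩ | ⟨hsub, -⟩⟩ :=
      h.exists_neighbor hA hlk.le hk hxy' hy' hl' (by omega)
    · exact ⟨s, hs, (Linked.single hA hAk hB hBk hAB).mono (by omega)⟩
    · obtain ⟨s, hs, hlink⟩ := ih B x' y' hB hBk hxy' hy' hsub hlen'
      exact ⟨s, hs, (Linked.step hA hAk hAB hlink)⟩

end IsConvexLabelling

/-! ### Consequences of the size hypothesis -/

/-- With `exists_window_lt`, this yields a window meeting a given `k`-island in fewer than `l`
points. With `k - l = m + 1`, a failure would force `2l(m+2) < l + m + 1`. -/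
theorem lt_mul_div_of_pos {N k l : ℕ} (hlk : l < k) (hl : 0 < l)
    (hN : 2 * ((k - l) * (k - l + 1) + k) ≤ N) : k < l * (N / k) := by
  obtain ⟨m, rfl⟩ := Nat.exists_eq_add_of_lt hlk
  rw [show l + m + 1 - l = m + 1 by omega] at hN
  by_contra! hc
  have h1 : N < N / (l + m + 1) * (l + m + 1) + (l + m + 1) :=
    Nat.lt_div_mul_add (by omega)
  have h2 := Nat.mul_le_mul_right (l + m + 1) hc
  have h3 := Nat.mul_lt_mul_of_pos_left h1 hl
  have h4 := Nat.mul_le_mul_left l hN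
  nlinarith [Nat.mul_le_mul_right (m * m) hl, Nat.mul_le_mul_right m hl]

theorem lt_succ_mul_div {N k l : ℕ} (hlk : l < k)
    (hN : 2 * ((k - l) * (k - l + 1) + k) ≤ N) : k < (l + 1) * (N / k) := by
  rcases Nat.eq_zero_or_pos l with rfl | hl
  · rw [Nat.sub_zero] at hN
    rw [zero_add, one_mul, ← Nat.succ_le_iff, Nat.le_div_iff_mul_le (by omega)]
    nlinarith
  · have := lt_mul_div_of_pos hlk hl hN
    rw [Nat.succ_mul]
    exact this.trans_le (Nat.le_add_right _ _)

theorem strip_inter_strip {P : Finset Plane} {r : Plane → ℕ} {a b c d : ℕ} :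
    strip P r a b ∩ strip P r c d = strip P r (max a c) (min b d) := by
  ext x
  simp only [mem_inter, mem_strip]
  constructor
  · rintro ⟨h1, h2⟩
    exact ⟨h1.1, by omega, by omega⟩
  · rintro ⟨h1, h2, h3⟩
    exact ⟨⟨h1, by omega, by omega⟩, h1, by omega, by omega⟩

/-- Consecutive windows have the form `U ∪ {p}` and `U ∪ {q}`; a set containing both or neither of
`p`, `q` meets them equally. -/
theorem card_insert_inter_eq {U G : Finset Plane} {p q : Plane} (hp : p ∉ U) (hq : q ∉ U)
    (h : p ∈ G ↔ q ∈ G) : #(insert p U ∩ G) = #(insert q U ∩ G) := by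
  by_cases hpG : p ∈ G
  · rw [insert_inter_of_mem hpG, insert_inter_of_mem (h.1 hpG),
      card_insert_of_notMem (fun h' => hp (mem_inter.1 h').1),
      card_insert_of_notMem (fun h' => hq (mem_inter.1 h').1)]
  · rw [insert_inter_of_notMem hpG, insert_inter_of_notMem (fun h' => hpG (h.2 h'))]

/-- A sequence with steps of size at most one that takes the value `l` only at a local maximum
`e - k` and at a local minimum `e` cannot exceed `l` if it goes below `l` somewhere. -/
theorem le_of_steps_of_local_extrema {c : ℕ → ℕ} {M l k e : ℕ} (hk : 2 ≤ k)
    (h1 : ∀ s < M, c (s + 1) ≤ c s + 1) (h2 : ∀ s < M, c s ≤ c (s + 1) + 1)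
    (h3 : ∀ s < M, s + 1 = e ∨ s + k = e → c (s + 1) ≤ c s)
    (h4 : ∀ s < M, s = e ∨ s + 1 + k = e → c s ≤ c (s + 1))
    (hbad : ∀ s ≤ M, c s = l → s = e ∨ s + k = e) {u : ℕ} (hu : u ≤ M) (hcu : c u < l) :
    ∀ s ≤ M, c s < l ∨ (c s = l ∧ s + k = e) := by
  -- The level `l` can be entered from below only at `e - k`. There the sequence does not rise, and
  -- the next index is not exceptional since `k ≥ 2`, so it falls back below `l`. At the minimum
  -- `e`, a value `l` has both neighbours above `l`.
  have key : ∀ s < M, ((c s < l ∨ (c s = l ∧ s + k = e)) ↔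
      (c (s + 1) < l ∨ (c (s + 1) = l ∧ s + 1 + k = e))) := by
    intro s hs
    have a1 := h1 s hs
    have a2 := h2 s hs
    have a3 := h3 s hs
    have a4 := h4 s hs
    have a5 := hbad s hs.le
    have a6 := hbad (s + 1) hs
    omega
  have all : ∀ s ≤ M, ((c s < l ∨ (c s = l ∧ s + k = e)) ↔
      (c 0 < l ∨ (c 0 = l ∧ 0 + k = e))) := by
    intro s
    induction s with
    | zero => simp
    | succ s ih => intro hs; rw [← key s hs, ih (by omega)]
  intro s hs
  exact (all s hs).2 ((all u hu).1 (Or.inl hcu))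

/-! ### From window to window -/

namespace IsConvexLabelling
variable {P : Finset Plane} {r : Plane → ℕ} {k l : ℕ}

theorem linked_window_add (h : IsConvexLabelling P r) (hlk : l < k) {a : ℕ}
    (ha : a + (k - l) + k ≤ #P) :
    Linked P k l 1 (strip P r a (a + k)) (strip P r (a + (k - l)) (a + (k - l) + k)) := by
  refine .single (h.isIsland_strip _ _) (h.card_window (by omega)) (h.isIsland_strip _ _)
    (h.card_window ha) ?_
  rw [strip_inter_strip, h.card_strip (by omega)]
  omega

theorem linked_window_add_mul (h : IsConvexLabelling P r) (hlk : l < k)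
    {a : ℕ} (j : ℕ) (ha : a + j * (k - l) + k ≤ #P) :
    Linked P k l j (strip P r a (a + k))
      (strip P r (a + j * (k - l)) (a + j * (k - l) + k)) := by
  induction j with
  | zero => simpa using .refl (h.isIsland_strip _ _) (h.card_window (by simpa using ha))
  | succ j ih =>
    rw [Nat.succ_mul, ← Nat.add_assoc] at ha ⊢
    exact (ih (by omega)).trans (h.linked_window_add hlk ha)

/-- A common neighbour of two consecutive windows, obtained from a labelling in which the two
points in which the windows differ are consecutive. -/
theorem exists_common_neighbor (h : IsConvexLabelling P r) (hgp : InGeneralPosition P)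
    (hlk : l < k) (hl2 : 2 * l ≤ k) (hl : 0 < l) (hN : k < l * (#P / k)) {a : ℕ}
    (ha : a + 1 + k ≤ #P) :
    ∃ G, IsIsland P G ∧ #G = k ∧ #(strip P r a (a + k) ∩ G) = l ∧
      #(strip P r (a + 1) (a + 1 + k) ∩ G) = l := by
  obtain ⟨p, hp, hpa⟩ := h.exists_eq (n := a) (by omega)
  obtain ⟨q, hq, hqa⟩ := h.exists_eq (n := a + k) (by omega)
  have hpq : p ≠ q := by rintro rfl; omega
  obtain ⟨g, hg, hgpq⟩ := hgp.exists_labelling hp hq hpq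
  set U := strip P r (a + 1) (a + k) with hU
  set W := strip P r a (a + k) with hWdef
  have hpU : p ∉ U := fun h' => by have := mem_strip.1 h'; omega
  have hqU : q ∉ U := fun h' => by have := mem_strip.1 h'; omega
  have hW : W = insert p U := by
    ext x
    simp only [hU, hWdef, mem_insert, mem_strip]
    constructor
    · rintro ⟨hx, h1, h2⟩
      by_cases hxa : r x = a
      · exact Or.inl (h.injOn hx hp (hxa.trans hpa.symm))
      · exact Or.inr ⟨hx, by omega, h2⟩
    · rintro (rfl | ⟨hx, h1, h2⟩)
      · exact ⟨hp, by omega, by omega⟩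
      · exact ⟨hx, by omega, h2⟩
  have hW' : strip P r (a + 1) (a + 1 + k) = insert q U := by
    ext x
    simp only [hU, mem_insert, mem_strip]
    constructor
    · rintro ⟨hx, h1, h2⟩
      by_cases hxa : r x = a + k
      · exact Or.inl (h.injOn hx hq (hxa.trans hqa.symm))
      · exact Or.inr ⟨hx, h1, by omega⟩
    · rintro (rfl | ⟨hx, h1, h2⟩)
      · exact ⟨hq, by omega, by omega⟩
      · exact ⟨hx, h1, by omega⟩
  have hWisl : IsIsland P W := h.isIsland_strip _ _
  have hWcard : #W = k := h.card_window (by omega)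
  have hWinj : Set.InjOn g W := hg.injOn.mono (by exact_mod_cast hWisl.subset)
  have hqW : q ∉ W := by
    rw [hW, mem_insert]
    rintro (h' | h')
    exacts [hpq h'.symm, hqU h']
  have hpW : p ∈ W := hW ▸ mem_insert_self p U
  suffices hsuff : ∃ G, IsIsland P G ∧ #G = k ∧ #(W ∩ G) = l ∧ (p ∈ G ↔ q ∈ G) by
    obtain ⟨G, h1, h2, h3, h4⟩ := hsuff
    refine ⟨G, h1, h2, h3, ?_⟩
    rw [hW', ← card_insert_inter_eq hpU hqU h4, ← hW, h3]
  have hUsub : U ⊆ P := strip_subset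
  have hUinj : Set.InjOn g U := hg.injOn.mono (by exact_mod_cast hUsub)
  have hUcard : #U = k - 1 := by rw [hU, h.card_strip (by omega)]; omega
  have hgq : g p + 2 ≤ #P := by have := hg.lt_card hq; omega
  -- Removing the two adjacent labels of `p` and `q` leaves two sides that share the `k - 1` points
  -- of `U`. If one side has fewer than `l`, the other has at least `k - l ≥ l`.
  obtain ⟨x, y, hxy, hy, hpqR, hR⟩ : ∃ x y, x ≤ y ∧ y ≤ #P ∧ (y ≤ g p ∨ g p + 2 ≤ x) ∧
      #(strip U g x y) = l := by
    have e1 := card_strip_add (T := U) (r := g) (Nat.zero_le (g p)) (Nat.le_add_right (g p) 2)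
    have e2 := card_strip_add (T := U) (r := g) (Nat.zero_le (g p + 2)) hgq
    have e3 : strip U g (g p) (g p + 2) = ∅ := by
      ext z
      simp only [mem_strip, notMem_empty, iff_false]
      rintro ⟨hz, h1, h2⟩
      rcases (show g z = g p ∨ g z = g q by omega) with h' | h'
      · exact hpU (hg.injOn (hUsub hz) hp h' ▸ hz)
      · exact hqU (hg.injOn (hUsub hz) hq h' ▸ hz)
    rw [hg.strip_eq_self hUsub] at e2
    rw [e3, card_empty] at e1
    by_cases hc : l ≤ #(strip U g 0 (g p))
    · obtain ⟨x, -, h1, h2⟩ := exists_strip_card_eq hUinj (Nat.zero_le _) hc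
      exact ⟨x, g p, h1, by omega, Or.inl le_rfl, h2⟩
    · obtain ⟨x, h0, h1, h2⟩ := exists_strip_card_eq hUinj hgq
        (show l ≤ #(strip U g (g p + 2) #P) by omega)
      exact ⟨x, #P, h1, le_rfl, Or.inr h0, h2⟩
  have hpR : ∀ T, p ∉ strip T g x y := fun T h' => by have := mem_strip.1 h'; omega
  have hqR : ∀ T, q ∉ strip T g x y := fun T h' => by have := mem_strip.1 h'; omega
  have hWR : strip W g x y = strip U g x y := by
    ext z
    rw [mem_strip (P := W), mem_strip (P := U), hW, mem_insert]
    constructor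
    · rintro ⟨rfl | hz, h1⟩
      · omega
      · exact ⟨hz, h1⟩
    · exact fun hz => ⟨Or.inr hz.1, hz.2⟩
  rw [← hWR] at hR
  rcases le_or_gt (x + k) y with hlen | hlen
  · obtain ⟨G, h1, h2, h3, h4⟩ := hg.exists_island_strip hWisl hlk.le hlen hy hR
    refine ⟨G, h1, h2, ?_, ?_⟩
    · rw [inter_eq_strip hWisl.subset h3 h4, hR]
    · exact ⟨fun h' => absurd (h4 h') (hpR P), fun h' => absurd (h4 h') (hqR P)⟩
  · obtain ⟨s, hs1, hs2, hs3⟩ := exists_window_superset hlen.le hy (show k ≤ #P by omega)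
    by_contra! hcon
    -- Only two windows separate `p` from `q`: the one starting at `q` and the one ending at `p`.
    -- Any other window with trace `l` would serve as `G`.
    have hbad : ∀ z ≤ #P - k, #(strip W g z (z + k)) = l → z = g p + 1 ∨ z + k = g p + 1 := by
      intro z hz hzl
      have h' := hcon (strip P g z (z + k)) (hg.isIsland_strip _ _) (hg.card_window (by omega))
        (by rw [strip_inter_of_subset hWisl.subset, hzl])
      by_contra! hne
      have hiff : p ∈ strip P g z (z + k) ↔ q ∈ strip P g z (z + k) := by
        rw [mem_strip, mem_strip]
        constructor
        · intro h''; exact ⟨hq, by omega, by omega⟩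
        · intro h''; exact ⟨hp, by omega, by omega⟩
      rcases h' with h' | h'
      · exact h'.2 (hiff.1 h'.1)
      · exact h'.1 (hiff.2 h'.2)
    have hYp : #(strip W g (g p) (g p + 1)) = 1 := by
      refine le_antisymm (card_strip_succ_le hWinj _) (card_pos.2 ⟨p, ?_⟩)
      exact mem_strip.2 ⟨hpW, le_rfl, by omega⟩
    have hYq : #(strip W g (g p + 1) (g p + 1 + 1)) = 0 := by
      rw [card_eq_zero]
      ext z
      simp only [mem_strip, notMem_empty, iff_false]
      rintro ⟨hz, h1, h2⟩
      exact hqW (hg.injOn (hWisl.subset hz) hq (by omega) ▸ hz)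
    obtain ⟨u, hu1, hu2⟩ := exists_window_lt (T := W) (r := g) (N := #P) (k := k) (j := l)
      (by rwa [hWcard])
    -- As `p ∈ W` and `q ∉ W`, the count has a local maximum at the window ending at `p` and a local
    -- minimum at the one starting at `q`.
    have hall := le_of_steps_of_local_extrema (c := fun s => #(strip W g s (s + k)))
      (M := #P - k) (l := l) (k := k) (e := g p + 1) (by omega)
      (fun s _ => by
        have := card_window_step (T := W) (r := g) s k
        have := card_strip_succ_le hWinj (s + k)
        omega)
      (fun s _ => by
        have := card_window_step (T := W) (r := g) s k
        have := card_strip_succ_le hWinj s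
        omega)
      (fun s _ hs => by
        have e1 := card_window_step (T := W) (r := g) s k
        have := card_strip_succ_le hWinj (s + k)
        rcases hs with hs | hs
        · obtain rfl : s = g p := by omega
          omega
        · rw [hs] at e1 this
          rw [hs]
          omega)
      (fun s _ hs => by
        have e1 := card_window_step (T := W) (r := g) s k
        have := card_strip_succ_le hWinj s
        rcases hs with hs | hs
        · subst hs
          omega
        · have hs' : s + k = g p := by omega
          rw [hs'] at e1
          rw [hs']
          omega)
      hbad (u := u) (by omega) hu2 s (by omega)
    -- The window at `s` has at least `l` points, so it must be the one ending at `p`. But then it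
    -- contains `p` besides the `l` points of the strip, a contradiction.
    have hsub : insert p (strip W g x y) ⊆ strip W g s (s + k) ∨ s + k ≠ g p + 1 := by
      by_cases hsk : s + k = g p + 1
      · refine Or.inl (insert_subset (mem_strip.2 ⟨hpW, by omega, by omega⟩) ?_)
        exact strip_mono hs1 hs2
      · exact Or.inr hsk
    have hle := card_le_card (strip_mono (P := W) (r := g) hs1 hs2)
    beta_reduce at hall
    rcases hsub with hsub | hsub
    · have := card_le_card hsub
      rw [card_insert_of_notMem (hpR W)] at this
      omega
    · omega

theorem linked_window_succ (h : IsConvexLabelling P r) (hgp : InGeneralPosition P)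
    (hlk : l < k) (hl2 : 2 * l ≤ k) (hN : 2 * ((k - l) * (k - l + 1) + k) ≤ #P) {a : ℕ}
    (ha : a + 1 + k ≤ #P) :
    Linked P k l 2 (strip P r a (a + k)) (strip P r (a + 1) (a + 1 + k)) := by
  obtain ⟨G, h1, h2, h3, h4⟩ : ∃ G, IsIsland P G ∧ #G = k ∧ #(strip P r a (a + k) ∩ G) = l ∧
      #(strip P r (a + 1) (a + 1 + k) ∩ G) = l := by
    rcases Nat.eq_zero_or_pos l with rfl | hl
    -- For `l = 0` a window disjoint from both is wanted; there is room for one on the left or on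
    -- the right.
    · have h6 : 6 * k ≤ #P := by rw [Nat.sub_zero] at hN; nlinarith
      obtain ⟨s, hs, hs'⟩ : ∃ s, s + k ≤ #P ∧ (s + k ≤ a ∨ a + 1 + k ≤ s) := by
        rcases le_or_gt k a with hka | hka
        · exact ⟨0, by omega, by omega⟩
        · exact ⟨a + 1 + k, by omega, by omega⟩
      refine ⟨strip P r s (s + k), h.isIsland_strip _ _, h.card_window hs, ?_, ?_⟩
      · rw [strip_inter_strip, h.card_strip (by omega)]; omega
      · rw [strip_inter_strip, h.card_strip (by omega)]; omega
    · exact h.exists_common_neighbor hgp hlk hl2 hl (lt_mul_div_of_pos hlk hl hN) ha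
  refine .step (h.isIsland_strip _ _) (h.card_window (by omega)) h3 ?_
  exact .single h1 h2 (h.isIsland_strip _ _) (h.card_window (by omega)) (by rwa [inter_comm])

theorem linked_window_add_units (h : IsConvexLabelling P r) (hgp : InGeneralPosition P)
    (hlk : l < k) (hl2 : 2 * l ≤ k) (hN : 2 * ((k - l) * (k - l + 1) + k) ≤ #P) {a : ℕ}
    (i : ℕ) (ha : a + i + k ≤ #P) :
    Linked P k l (2 * i) (strip P r a (a + k)) (strip P r (a + i) (a + i + k)) := by
  induction i with
  | zero => exact .refl (h.isIsland_strip _ _) (h.card_window (by omega))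
  | succ i ih =>
    exact (ih (by omega)).trans (h.linked_window_succ hgp hlk hl2 hN (by omega))

theorem linked_windows_of_le (h : IsConvexLabelling P r) (hgp : InGeneralPosition P)
    (hlk : l < k) (hl2 : 2 * l ≤ k) (hN : 2 * ((k - l) * (k - l + 1) + k) ≤ #P) {a b : ℕ}
    (hab : a ≤ b) (hb : b + k ≤ #P) :
    Linked P k l (#P / (k - l) + 2 * (k - l)) (strip P r a (a + k)) (strip P r b (b + k)) := by
  have hm : 0 < k - l := by omega
  have hdm := Nat.div_add_mod' (b - a) (k - l)
  have hmod := Nat.mod_lt (b - a) hm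
  set j := (b - a) / (k - l) with hj
  set i := (b - a) % (k - l) with hi
  have hjle : j ≤ #P / (k - l) := Nat.div_le_div_right (by omega)
  -- `j` shifts by `k - l` cost one step each; the remaining `i < k - l` unit shifts cost two each.
  have hb' : a + j * (k - l) + i = b := by omega
  have h1 := h.linked_window_add_mul hlk (a := a) j (by omega)
  have h2 := h.linked_window_add_units hgp hlk hl2 hN (a := a + j * (k - l)) i (by omega)
  rw [hb'] at h2
  exact (h1.trans h2).mono (by omega)

theorem linked_windows (h : IsConvexLabelling P r) (hgp : InGeneralPosition P)
    (hlk : l < k) (hl2 : 2 * l ≤ k) (hN : 2 * ((k - l) * (k - l + 1) + k) ≤ #P) {a b : ℕ}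
    (ha : a + k ≤ #P) (hb : b + k ≤ #P) :
    Linked P k l (#P / (k - l) + 2 * (k - l)) (strip P r a (a + k)) (strip P r b (b + k)) := by
  rcases le_total a b with hab | hab
  · exact h.linked_windows_of_le hgp hlk hl2 hN hab hb
  · exact (h.linked_windows_of_le hgp hlk hl2 hN hab ha).symm

end IsConvexLabelling

/-! ### Sets of quadratic size -/

/-- In point sets of size quadratic in `k - l`, any two `k`-islands are `O(k - l)` steps apart. -/
theorem InGeneralPosition.linked_of_card_le {P A B : Finset Plane} {k l : ℕ}
    (hgp : InGeneralPosition P)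
    (hlk : l < k) (hl2 : 2 * l ≤ k) (hN : 2 * ((k - l) * (k - l + 1) + k) ≤ #P)
    (hN' : #P ≤ 4 * ((k - l) * (k - l + 1) + k) + 2)
    (hA : IsIsland P A) (hAk : #A = k) (hB : IsIsland P B) (hBk : #B = k) :
    Linked P k l (34 * (k - l)) A B := by
  have hk : k ≤ #P := by omega
  obtain ⟨r, hr⟩ := hgp.exists_labelling' (by omega)
  obtain ⟨m, hm⟩ : ∃ m, k - l = m + 1 := ⟨k - l - 1, by omega⟩
  have hkm : k ≤ 2 * (m + 1) := by omega
  have hquad : #P ≤ (4 * (m + 1) + 14) * (m + 1) := by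
    rw [hm] at hN'
    nlinarith
  -- The crude exponent `m + 6`, linear rather than logarithmic in `k - l`, is affordable because
  -- the sweep already costs O(k-l).
  have hpow : (4 * (m + 1) + 14) * (m + 1) ≤ 2 ^ (m + 6) := by
    clear * -
    induction m with
    | zero => norm_num
    | succ m ih =>
      rcases m with _ | m
      · norm_num
      rcases m with _ | m
      · norm_num
      rw [show m + 1 + 1 + 1 + 6 = (m + 1 + 1 + 6) + 1 by omega, pow_succ]
      nlinarith
  have hdiv : #P / (k - l) ≤ 4 * (m + 1) + 14 := by
    rw [hm]
    exact Nat.div_le_of_le_mul (by linarith)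
  have hwin : ∀ A, IsIsland P A → #A = k →
      ∃ s, s + k ≤ #P ∧ Linked P k l (m + 6 + 1) A (strip P r s (s + k)) := fun A hA hAk =>
    hr.exists_linked_window hlk hl2 hk (lt_succ_mul_div hlk hN) (m + 6) A 0 #P hA hAk
      (Nat.zero_le _) le_rfl (fun x hx => mem_strip.2
        ⟨hA.subset hx, Nat.zero_le _, hr.lt_card (hA.subset hx)⟩) (by omega)
  obtain ⟨s, hs, h1⟩ := hwin A hA hAk
  obtain ⟨s', hs', h2⟩ := hwin B hB hBk
  -- The total is at most `2(m+7) + (4(m+1)+14) + 2(m+1) = 8m + 34 ≤ 34(m+1)`.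
  exact ((h1.trans (hr.linked_windows hgp hlk hl2 hN hs hs')).trans h2.symm).mono (by omega)

/-! ### Order statistics and ham-sandwich cuts -/

/-- The `l`-th smallest value of `f` on `T`. -/
noncomputable def lowStat (T : Finset Plane) (l : ℕ) (h : l ≤ #T) (f : Plane → ℝ) : ℝ :=
  (powersetCard l T).inf' (powersetCard_nonempty.2 h)
    -- The default `0` is reached only when `l = 0`.
    fun S => if hS : S.Nonempty then S.sup' hS f else 0

/-- The min-max form pays off here: finite infima and suprema of continuous functions are
continuous. -/
theorem continuous_lowStat {T : Finset Plane} {l : ℕ} (h : l ≤ #T) {f : ℝ → Plane → ℝ}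
    (hf : ∀ x, Continuous fun θ => f θ x) : Continuous fun θ => lowStat T l h (f θ) := by
  refine Continuous.finset_inf'_apply _ fun S _ => ?_
  by_cases hS : S.Nonempty
  · simp only [hS, dite_true]
    exact Continuous.finset_sup'_apply hS fun x _ => hf x
  · simp only [hS, dite_false]
    exact continuous_const

theorem le_card_le_lowStat {T : Finset Plane} {l : ℕ} (h : l ≤ #T) (f : Plane → ℝ) :
    l ≤ #{x ∈ T | f x ≤ lowStat T l h f} := by
  obtain ⟨S, hS, he⟩ := exists_mem_eq_inf' (powersetCard_nonempty.2 h)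
    fun S => if hS : S.Nonempty then S.sup' hS f else 0
  rw [mem_powersetCard] at hS
  refine hS.2.symm.le.trans (card_le_card fun x hx => mem_filter.2 ⟨hS.1 hx, ?_⟩)
  rw [lowStat, he, dif_pos ⟨x, hx⟩]
  exact le_sup' f hx

theorem lowStat_le {T S : Finset Plane} {l : ℕ} (h : l ≤ #T) (f : Plane → ℝ) (hl : 0 < l)
    (hS : S ⊆ T) (hSl : l ≤ #S) {t : ℝ} (ht : ∀ x ∈ S, f x ≤ t) : lowStat T l h f ≤ t := by
  obtain ⟨S', hS', hc⟩ := exists_subset_card_eq hSl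
  have hne : S'.Nonempty := card_pos.1 (by omega)
  refine (inf'_le _ (mem_powersetCard.2 ⟨hS'.trans hS, hc⟩)).trans ?_
  rw [dif_pos hne]
  exact sup'_le hne f fun x hx => ht x (hS' hx)

theorem card_lt_lowStat_lt {T : Finset Plane} {l : ℕ} (h : l ≤ #T) (f : Plane → ℝ)
    (hl : 0 < l) : #{x ∈ T | f x < lowStat T l h f} < l := by
  by_contra! hc
  have hne : ({x ∈ T | f x < lowStat T l h f} : Finset Plane).Nonempty := card_pos.1 (by omega)
  obtain ⟨x, hx, he⟩ := exists_mem_eq_sup' hne f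
  have h1 := lowStat_le h f hl (filter_subset _ T) hc (t := f x)
    fun y hy => he ▸ le_sup' f hy
  exact absurd (mem_filter.1 hx).2 h1.not_gt

/-- For `-f` the statistic is minus the `l`-th largest value of `f`, which is at least the `l`-th
smallest once `2l ≤ #T`. Their average, `midStat`, therefore lies between them. -/
theorem lowStat_neg_le {T : Finset Plane} {l : ℕ} (h : l ≤ #T) (f : Plane → ℝ)
    (hl : 0 < l) (h2 : 2 * l ≤ #T) : lowStat T l h (-f) ≤ -lowStat T l h f := by
  refine lowStat_le h (-f) hl (filter_subset (fun x => ¬ f x < lowStat T l h f) T) ?_ ?_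
  · have h1 := card_lt_lowStat_lt h f hl
    have h3 := card_filter_add_card_filter_not (s := T) (fun x => f x < lowStat T l h f)
    omega
  · intro x hx
    have := (mem_filter.1 hx).2
    rw [Pi.neg_apply]
    linarith

/-- A value that splits `T` evenly, depending continuously and oddly on `f`. -/
noncomputable def midStat (T : Finset Plane) (l : ℕ) (h : l ≤ #T) (f : Plane → ℝ) : ℝ :=
  (lowStat T l h f - lowStat T l h (-f)) / 2

theorem midStat_neg {T : Finset Plane} {l : ℕ} (h : l ≤ #T) (f : Plane → ℝ) :
    midStat T l h (-f) = -midStat T l h f := by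
  rw [midStat, midStat, neg_neg]; ring

theorem le_card_le_midStat {T : Finset Plane} {l : ℕ} (h : l ≤ #T) (f : Plane → ℝ)
    (hl : 0 < l) (h2 : 2 * l ≤ #T) : l ≤ #{x ∈ T | f x ≤ midStat T l h f} := by
  refine (le_card_le_lowStat h f).trans (card_le_card fun x hx => ?_)
  rw [mem_filter] at hx ⊢
  refine ⟨hx.1, hx.2.trans ?_⟩
  have := lowStat_neg_le h f hl h2
  rw [midStat]
  linarith

theorem le_card_midStat_le {T : Finset Plane} {l : ℕ} (h : l ≤ #T) (f : Plane → ℝ)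
    (hl : 0 < l) (h2 : 2 * l ≤ #T) : l ≤ #{x ∈ T | midStat T l h f ≤ f x} := by
  have h1 := le_card_le_midStat h (-f) hl h2
  rw [midStat_neg] at h1
  simpa only [Pi.neg_apply, neg_le_neg_iff] using h1

/-- A ham-sandwich cut: a line with many points of both sets on each closed side. -/
theorem exists_ham_sandwich {A B : Finset Plane} {l : ℕ} (hl : 0 < l) (hA : 2 * l ≤ #A)
    (hB : 2 * l ≤ #B) : ∃ a b t : ℝ, 0 < a ^ 2 + b ^ 2 ∧
      l ≤ #{x ∈ A | planeFunctional a b x ≤ t} ∧ l ≤ #{x ∈ A | t ≤ planeFunctional a b x} ∧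
      l ≤ #{x ∈ B | planeFunctional a b x ≤ t} ∧ l ≤ #{x ∈ B | t ≤ planeFunctional a b x} := by
  have hA' : l ≤ #A := by omega
  have hB' : l ≤ #B := by omega
  let f : ℝ → Plane → ℝ := fun θ x => planeFunctional (Real.cos θ) (Real.sin θ) x
  have hf : ∀ x, Continuous fun θ => f θ x := fun x => by
    simp only [f, planeFunctional_apply]; fun_prop
  have hfneg : ∀ x, Continuous fun θ => (-f θ) x := fun x => (hf x).neg
  let F : ℝ → ℝ := fun θ => midStat A l hA' (f θ) - midStat B l hB' (f θ)
  have hF : Continuous F :=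
    (((continuous_lowStat hA' hf).sub (continuous_lowStat hA' hfneg)).div_const 2).sub
      (((continuous_lowStat hB' hf).sub (continuous_lowStat hB' hfneg)).div_const 2)
  -- Half a turn negates the functional, so by oddness of `midStat` the difference `F` changes sign.
  have hpi : f Real.pi = -f 0 := by
    ext x
    simp [f, planeFunctional_apply]
  have hFpi : F Real.pi = -F 0 := by
    simp only [F, hpi, midStat_neg]; ring
  obtain ⟨θ, hθ⟩ : ∃ θ, F θ = 0 := by
    rcases le_total (F 0) 0 with h0 | h0
    · exact mem_range_of_exists_le_of_exists_ge hF ⟨0, h0⟩ ⟨Real.pi, by linarith⟩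
    · exact mem_range_of_exists_le_of_exists_ge hF ⟨Real.pi, by linarith⟩ ⟨0, h0⟩
  have he : midStat A l hA' (f θ) = midStat B l hB' (f θ) := sub_eq_zero.1 hθ
  refine ⟨Real.cos θ, Real.sin θ, midStat A l hA' (f θ), by rw [Real.cos_sq_add_sin_sq]; norm_num,
    le_card_le_midStat hA' (f θ) hl hA, le_card_midStat_le hA' (f θ) hl hA, ?_, ?_⟩
  · rw [he]; exact le_card_le_midStat hB' (f θ) hl hB
  · rw [he]; exact le_card_midStat_le hB' (f θ) hl hB

/-! ### Halving the point set -/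

/-- Some island with about half of the points meets both `A` and `B` in many points. -/
theorem InGeneralPosition.exists_half_island {P A B : Finset Plane} (hgp : InGeneralPosition P)
    {l : ℕ} (hA : 2 * l ≤ #A) (hB : 2 * l ≤ #B) (hAP : A ⊆ P) (hBP : B ⊆ P) :
    ∃ Q, IsIsland P Q ∧ #Q ≤ #P / 2 + 1 ∧ l ≤ #(A ∩ Q) ∧ l ≤ #(B ∩ Q) := by
  rcases Nat.eq_zero_or_pos l with rfl | hl
  · exact ⟨∅, isIsland_empty P, by simp, Nat.zero_le _, Nat.zero_le _⟩
  obtain ⟨a, b, t, hab, hA1, hA2, hB1, hB2⟩ := exists_ham_sandwich hl hA hB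
  set f := planeFunctional a b with hf
  have hcard := card_union_add_card_inter {x ∈ P | f x ≤ t} {x ∈ P | t ≤ f x}
  have hun : #({x ∈ P | f x ≤ t} ∪ {x ∈ P | t ≤ f x}) ≤ #P :=
    card_le_card (union_subset (filter_subset _ _) (filter_subset _ _))
  have hin : #({x ∈ P | f x ≤ t} ∩ {x ∈ P | t ≤ f x}) ≤ 2 := by
    refine (card_le_card fun x hx => ?_).trans (hgp.card_line_le hab t)
    rw [mem_inter, mem_filter, mem_filter] at hx
    exact mem_filter.2 ⟨hx.1.1, le_antisymm hx.1.2 hx.2.2⟩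
  have hinter : ∀ (T : Finset Plane) (p : Plane → Prop), T ⊆ P →
      #{x ∈ T | p x} ≤ #(T ∩ {x ∈ P | p x}) := fun T p hT =>
    card_le_card fun x hx => by
      rw [mem_filter] at hx
      exact mem_inter.2 ⟨hx.1, mem_filter.2 ⟨hT hx.1, hx.2⟩⟩
  -- The two closed sides share at most two points, so the smaller has at most `(#P + 2) / 2`
  -- points.
  rcases le_total (#{x ∈ P | f x ≤ t}) (#{x ∈ P | t ≤ f x}) with hle | hle
  · exact ⟨{x ∈ P | f x ≤ t}, isIsland_of_mem_iff (convex_halfSpace_le f.isLinear t)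
      fun x => mem_filter, by omega, hA1.trans (hinter A _ hAP), hB1.trans (hinter B _ hBP)⟩
  · exact ⟨{x ∈ P | t ≤ f x}, isIsland_of_mem_iff (convex_halfSpace_ge f.isLinear t)
      fun x => mem_filter, by omega, hA2.trans (hinter A _ hAP), hB2.trans (hinter B _ hBP)⟩

/-- One can move from a `k`-island into any sufficiently large island meeting it in at least
`l` points. -/
theorem IsIsland.exists_neighbor_within {P Q A : Finset Plane} {k l : ℕ}
    (hgp : InGeneralPosition P) (hQ : IsIsland P Q) (hlk : l < k)
    (hN : 2 * ((k - l) * (k - l + 1) + k) ≤ #Q) (hA : IsIsland P A) (hAk : #A = k)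
    (hAQ : l ≤ #(A ∩ Q)) : ∃ A', IsIsland Q A' ∧ #A' = k ∧ #(A ∩ A') = l := by
  obtain ⟨r, hr⟩ := (hgp.subset hQ.subset).exists_labelling' (by omega)
  have hT := hA.inter_of_subset hQ.subset
  obtain ⟨A', h1, h2, h3, -⟩ := hr.exists_neighbor hT hlk.le (by omega) (Nat.zero_le _) le_rfl
    (by rwa [hr.strip_eq_self hT.subset])
    ((card_le_card inter_subset_left).trans_lt (by rw [hAk]; exact lt_succ_mul_div hlk hN))
  refine ⟨A', h1, h2, ?_⟩
  rwa [inter_assoc, inter_eq_right.2 h1.subset] at h3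

theorem InGeneralPosition.linked {k l : ℕ} (hlk : l < k) (hl2 : 2 * l ≤ k) (t : ℕ) :
    ∀ {P A B : Finset Plane}, InGeneralPosition P →
      2 * ((k - l) * (k - l + 1) + k) ≤ #P →
      #P ≤ 4 * ((k - l) * (k - l + 1) + k) * 2 ^ t + 2 →
      IsIsland P A → #A = k → IsIsland P B → #B = k →
      Linked P k l (2 * t + 34 * (k - l)) A B := by
  induction t with
  | zero =>
    intro P A B hgp hN hN' hA hAk hB hBk
    exact (hgp.linked_of_card_le hlk hl2 hN (by simpa using hN') hA hAk hB hBk).mono (by omega)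
  | succ t ih =>
    intro P A B hgp hN hN' hA hAk hB hBk
    by_cases hsmall : #P ≤ 4 * ((k - l) * (k - l + 1) + k) + 2
    · exact (hgp.linked_of_card_le hlk hl2 hN hsmall hA hAk hB hBk).mono (by omega)
    obtain ⟨Q₀, hQ₀, hc, hA₀, hB₀⟩ := hgp.exists_half_island (l := l) (A := A) (B := B)
      (by omega) (by omega) hA.subset hB.subset
    -- Growing the half to exactly `#P / 2 + 1` points keeps the lower size bound valid. The `+ 2`
    -- in the upper bound is preserved because `2` is fixed by `n ↦ n / 2 + 1`.
    obtain ⟨Q, hQQ, hQ, hQc⟩ := hQ₀.exists_superset_card_eq hc (by omega)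
    obtain ⟨A', hA', hAk', hAA'⟩ := hQ.exists_neighbor_within hgp hlk (by omega) hA hAk
      (hA₀.trans (card_le_card (inter_subset_inter_left hQQ)))
    obtain ⟨B', hB', hBk', hBB'⟩ := hQ.exists_neighbor_within hgp hlk (by omega) hB hBk
      (hB₀.trans (card_le_card (inter_subset_inter_left hQQ)))
    have h1 := Linked.single hA hAk (hQ.trans hA') hAk' hAA'
    have h2 := Linked.single hB hBk (hQ.trans hB') hBk' hBB'
    have h3 := (ih (hgp.subset hQ.subset) (by omega)
      (by rw [pow_succ, ← mul_assoc] at hN'; omega) hA' hAk' hB' hBk').of_isIsland hQ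
    exact ((h1.trans h3).trans h2.symm).mono (by omega)

end

/-! ### The diameter bound -/

theorem theorem3 :
    ∃ C₁ C₂ : ℝ, ∀ (P : Finset Plane) (k l : ℕ),
      InGeneralPosition P →
      l < k →
      2 * ((k - l) * (k - l + 1) + k) ≤ P.card →
      (l : ℝ) ≤ (k : ℝ) / 2 →
      (islandJohnsonGraph P k l).Connected ∧
        ((islandJohnsonGraph P k l).diam : ℝ) ≤
          C₁ * Real.log (P.card : ℝ) + C₂ * ((k : ℝ) - (l : ℝ)) := by
  refine ⟨2 / Real.log 2, 34, fun P k l hgp hlk hN hl => ?_⟩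
  have hl2 : 2 * l ≤ k := by
    have : (2 * l : ℝ) ≤ k := by linarith
    exact_mod_cast this
  set d := 2 * Nat.log 2 P.card + 34 * (k - l) with hd
  have hpow : P.card < 2 ^ Nat.log 2 P.card * 2 := by
    rw [← pow_succ]; exact Nat.lt_pow_succ_log_self (by norm_num) _
  -- The logarithm of `n` to base 2, rounded down, is enough halvings, since `n < 2 * 2 ^ t` for
  -- that `t`.
  have hbig : P.card ≤ 4 * ((k - l) * (k - l + 1) + k) * 2 ^ Nat.log 2 P.card + 2 := by
    have h1 := Nat.mul_le_mul_right (2 ^ Nat.log 2 P.card)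
      (show 4 ≤ 4 * ((k - l) * (k - l + 1) + k) by omega)
    omega
  have hedist : ∀ X Y : KIsland P k, (islandJohnsonGraph P k l).edist X Y ≤ d := fun X Y =>
    (hgp.linked hlk hl2 (Nat.log 2 P.card) hN hbig X.2.1 X.2.2 Y.2.1 Y.2.2).edist_le hlk
  have hediam : (islandJohnsonGraph P k l).ediam ≤ d := SimpleGraph.ediam_le_of_edist_le hedist
  have hnonempty : Nonempty (KIsland P k) := by
    obtain ⟨I, -, hI, hIk⟩ := (isIsland_empty P).exists_superset_card_eq (j := k) (by simp)
      (by omega)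
    exact ⟨⟨I, hI, hIk⟩⟩
  refine ⟨SimpleGraph.connected_of_ediam_ne_top
    (ne_top_of_le_ne_top (ENat.natCast_ne_top d) hediam), ?_⟩
  have hdiam : (islandJohnsonGraph P k l).diam ≤ d :=
    ENat.toNat_le_of_le_natCast hediam
  have hlog : (Nat.log 2 P.card : ℝ) ≤ Real.log P.card / Real.log 2 := by
    have := Real.natLog_le_logb P.card 2
    rwa [Real.logb, Nat.cast_ofNat] at this
  calc ((islandJohnsonGraph P k l).diam : ℝ) ≤ (d : ℝ) := by exact_mod_cast hdiam
    _ = 2 * Nat.log 2 P.card + 34 * ((k : ℝ) - l) := by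
      rw [hd]; push_cast [Nat.cast_sub hlk.le]; ring
    _ ≤ 2 * (Real.log P.card / Real.log 2) + 34 * ((k : ℝ) - l) := by gcongr
    _ = _ := by ring
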